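/- Let $d\in\mathbb N$ and let $f\in L^2(\mathbb R^d)$ be complex-valued. Write $$W(f,f)(x,\xi)=\int_{\mathbb R^d} f\!\left(x+\tfrac t2\right)\overline{f\!\left(x-\tfrac t2\right)}\,e^{-2\pi i\,\xi\cdot t}\,dt\qquad (x,\xi\in\mathbb R^d)$$ for the Wigner distribution of $f$ and, for $g\in L^2(\mathbb R^d)$, $$V_gf(x,\xi)=\int_{\mathbb R^d} f(t)\,\overline{g(t-x)}\,e^{-2\pi i\,\xi\cdot t}\,dt\qquad (x,\xi\in\mathbb R^d)$$ for the short-time Fourier transform of $f$ with window $g$. Let $If(t)=f(-t)$. Call $f$ a generalized Gaussian if $f\in L^2(\mathbb R^d)$ and $f=e^{Q}$ almost everywhere for some polynomial $Q$ of degree at most $2$ in $d$ real variables with complex coefficients. (i) If $W(f,f)(x,\xi)\neq 0$ for all $x,\xi\in\mathbb R^d$, then $f$ is a generalized Gaussian. (ii) If $V_{If}f(x,\xi)\neq 0$ for all $x,\xi\in\mathbb R^d$, then $f$ is a generalized Gaussian. -/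

import Mathlib

open MeasureTheory Complex

noncomputable section

namespace TimeFrequency

/-- The cross-Wigner distribution
`W(f,g)(x,ξ) = ∫ f(x + t/2) conj(g(x - t/2)) exp(-2πi ξ·t) dt` on `ℝ^d × ℝ^d`.
For `f, g ∈ L²(ℝ^d)` the integrand is integrable for every `(x, ξ)`. -/
def wigner {d : ℕ} (f g : EuclideanSpace ℝ (Fin d) → ℂ)
    (x ξ : EuclideanSpace ℝ (Fin d)) : ℂ :=
  ∫ t : EuclideanSpace ℝ (Fin d),
    f (x + (1 / 2 : ℝ) • t) * (starRingEnd ℂ) (g (x - (1 / 2 : ℝ) • t)) *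
      cexp (-2 * (Real.pi : ℂ) * I * ((inner ℝ ξ t : ℝ) : ℂ))

/-- The short-time Fourier transform of `f` with window `g`,
`V_g f(x,ξ) = ∫ f(t) conj(g(t - x)) exp(-2πi ξ·t) dt` on `ℝ^d × ℝ^d`. -/
def stft {d : ℕ} (g f : EuclideanSpace ℝ (Fin d) → ℂ)
    (x ξ : EuclideanSpace ℝ (Fin d)) : ℂ :=
  ∫ t : EuclideanSpace ℝ (Fin d),
    f t * (starRingEnd ℂ) (g (t - x)) *
      cexp (-2 * (Real.pi : ℂ) * I * ((inner ℝ ξ t : ℝ) : ℂ))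

/-- The reflection `(If)(t) = f(-t)`. -/
def reflection {d : ℕ} (f : EuclideanSpace ℝ (Fin d) → ℂ) :
    EuclideanSpace ℝ (Fin d) → ℂ :=
  fun t => f (-t)

/-- A generalized Gaussian: an element of `L²(ℝ^d)` of the form `e^Q`, where `Q` is a
polynomial with complex coefficients of degree at most two in the `d` real variables.
(Square-integrability forces the real part of the quadratic form of `Q` to be negative
definite.) The equality is almost everywhere, as for elements of `L²`. -/
def IsGeneralizedGaussian {d : ℕ} (f : EuclideanSpace ℝ (Fin d) → ℂ) : Prop :=
  MemLp f 2 volume ∧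
    ∃ Q : MvPolynomial (Fin d) ℂ, Q.totalDegree ≤ 2 ∧
      f =ᵐ[volume] fun x => cexp (MvPolynomial.eval (fun i => ((x i : ℝ) : ℂ)) Q)

end TimeFrequency

end

noncomputable section

namespace TimeFrequency

open scoped FourierTransform

/-! The substance is (i), Hudson's theorem; (ii) reduces to it because `W(f,f)(x,ξ)` is a
nonvanishing multiple of `V_{If}f(2x,2ξ)`.

`W(f,f)` is real and continuous along enough lines to connect all points, so without zeros it has
one sign. Put `g = f exp(-π|t|²)`. For complex `z`, the squared modulus of `∫ g(t) exp(2πz ξ·t) dt`,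
written in midpoint and difference variables, is an average of `W(f,f)` against positive Gaussian
weights, so it cannot vanish (`integral_mul_gaussian_ne_zero`). In `z` this integral is entire of
order at most two, hence the exponential of a quadratic polynomial (`entire_eq_cexp_quadratic`). The
coefficients come from the first two derivatives at `z = 0`, that is, from moments of `g`, so they
are polynomial in `ξ`; complex analysis in one variable thus serves every `d`.

Taking `z = -i` shows that the Fourier transform of `g` is the exponential of a quadratic
polynomial. By Riemann-Lebesgue it must decay, so it is a genuine Gaussian; Fourier inversion gives
`g = exp Q` almost everywhere, and dividing by the Gaussian factor gives `f`. -/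

/-! ### Zero-free entire functions of order at most two -/

/-- An entire function whose norm grows at most quadratically is a quadratic polynomial. -/
theorem entire_eq_quadratic_of_norm_le {h : ℂ → ℂ} (hh : Differentiable ℂ h) {A B : ℝ}
    (hA : 0 ≤ A) (hB : 0 ≤ B) (hb : ∀ z, ‖h z‖ ≤ A + B * ‖z‖ ^ 2) (z : ℂ) :
    h z = h 0 + deriv h 0 * z + iteratedDeriv 2 h 0 / 2 * z ^ 2 := by
  have key : ∀ n, 3 ≤ n → iteratedDeriv n h 0 = 0 := by
    intro n hn
    -- Cauchy's estimate on the circle of radius `R`: for `n ≥ 3` and `R ≥ 1`, `R² / Rⁿ ≤ R⁻¹`.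
    have hle : ∀ R : ℝ, 1 ≤ R → ‖iteratedDeriv n h 0‖ ≤ n.factorial * (A + B) * R⁻¹ := by
      intro R hR
      have hR0 : 0 < R := by linarith
      have h1 := Complex.norm_iteratedDeriv_le_of_forall_mem_sphere_norm_le n hR0
        (c := 0) (f := h) (C := (A + B) * R ^ 2) hh.diffContOnCl (by
          intro w hw
          have hw' : ‖w‖ = R := by simpa using hw
          refine (hb w).trans ?_
          rw [hw']
          nlinarith [one_le_pow₀ hR (n := 2)])
      refine h1.trans ?_
      rw [div_le_iff₀ (by positivity), ← mul_assoc, mul_assoc _ R⁻¹]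
      gcongr
      rw [← div_eq_inv_mul, le_div_iff₀ hR0, ← pow_succ]
      exact pow_le_pow_right₀ hR hn
    have hlim : Filter.Tendsto (fun R : ℝ => n.factorial * (A + B) * R⁻¹) Filter.atTop (nhds 0) := by
      simpa using (tendsto_inv_atTop_zero (𝕜 := ℝ)).const_mul (n.factorial * (A + B))
    have := ge_of_tendsto hlim (Filter.eventually_atTop.2 ⟨1, hle⟩)
    exact norm_le_zero_iff.1 this
  have hs := Complex.hasSum_taylorSeries_of_entire hh 0 z
  have hs2 := hasSum_sum_of_ne_finset_zero (L := SummationFilter.unconditional ℕ) (s := Finset.range 3) (f := fun n : ℕ => ((n.factorial : ℂ)⁻¹ • (z - 0) ^ n • iteratedDeriv n h 0)) (by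
    intro n hn
    rw [key n (by simpa using hn)]; simp)
  rw [hs.unique hs2]
  simp [Finset.sum_range_succ, iteratedDeriv_one, Nat.factorial]
  ring

/-- A nowhere vanishing entire function of order at most two is the exponential of
a quadratic polynomial. -/
theorem entire_eq_cexp_quadratic {F F' : ℂ → ℂ} {F'' : ℂ} (hF : ∀ z, HasDerivAt F (F' z) z)
    (hF' : HasDerivAt F' F'' 0) (h0 : ∀ z, F z ≠ 0) {C K : ℝ} (hK : 0 ≤ K)
    (hb : ∀ z, ‖F z‖ ≤ C * Real.exp (K * ‖z‖ ^ 2)) (z : ℂ) :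
    F z = F 0 * cexp (F' 0 / F 0 * z + (F'' / F 0 - (F' 0 / F 0) ^ 2) / 2 * z ^ 2) := by
  have hFd : Differentiable ℂ F := fun z => (hF z).differentiableAt
  have hF'eq : F' = deriv F := funext fun z => (hF z).deriv.symm
  have hF'd : Differentiable ℂ F' := by
    rw [hF'eq, ← differentiableOn_univ]
    exact hFd.differentiableOn.deriv isOpen_univ
  have hq : Differentiable ℂ (fun z => F' z / F z) := hF'd.div hFd h0
  -- A primitive of the logarithmic derivative with `h 0 = 0` serves as `log (F / F 0)`.
  obtain ⟨h, hh0, hh⟩ := hq.isExactOn_univ.with_val_at 0 0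
  replace hh : ∀ z, HasDerivAt h (F' z / F z) z := fun z => hh z (Set.mem_univ z)
  have hhd : Differentiable ℂ h := fun z => (hh z).differentiableAt
  have hconst : ∀ z, F z * cexp (-h z) = F 0 := by
    have hd : ∀ z, HasDerivAt (fun z => F z * cexp (-h z)) 0 z := by
      intro z
      refine ((hF z).mul ((hh z).neg.cexp)).congr_deriv ?_
      field_simp [h0 z]
      ring
    intro z
    have := is_const_of_deriv_eq_zero (fun z => (hd z).differentiableAt) (fun z => (hd z).deriv) z 0
    simpa [hh0] using this
  have hFe : ∀ z, F z = F 0 * cexp (h z) := by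
    intro z
    rw [← hconst z, mul_assoc, ← Complex.exp_add]; simp
  have hF0 : 0 < ‖F 0‖ := norm_pos_iff.2 (h0 0)
  have hC : 0 < C := by
    have := hb 0
    simp at this
    linarith
  -- The absolute value and the `+ 1` make the bound strictly positive, as Borel-Carathéodory
  -- requires.
  set M0 : ℝ := |Real.log (C / ‖F 0‖)| + 1
  have hre : ∀ z, (h z).re ≤ M0 + K * ‖z‖ ^ 2 := by
    intro z
    have h1 := hb z
    rw [hFe z, norm_mul, Complex.norm_exp, mul_comm, ← le_div_iff₀ hF0] at h1
    have h2 : (h z).re ≤ Real.log (C / ‖F 0‖) + K * ‖z‖ ^ 2 := by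
      rw [← Real.exp_le_exp, Real.exp_add, Real.exp_log (by positivity)]
      exact h1.trans_eq (by ring)
    have := le_abs_self (Real.log (C / ‖F 0‖))
    simp only [M0]; linarith
  have hM0 : 0 < M0 := by positivity
  have hnorm : ∀ z, ‖h z‖ ≤ (2 * M0 + 2 * K) + (4 * M0 + 4 * K + 4 * M0 * K + 8 * K) * ‖z‖ ^ 2 := by
    intro z
    set r := ‖z‖
    have hr : 0 ≤ r := norm_nonneg z
    -- The radius `2r + 1` exceeds `r` even at `r = 0`, and the denominator `R - r = r + 1` keeps
    -- the bound quadratic.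
    have hBC := Complex.borelCaratheodory_zero (f := h) (M := M0 + K * (2 * r + 1) ^ 2) (R := 2 * r + 1)
      (z := z) (by positivity) hhd.differentiableOn (by
        intro w hw
        have hw' : ‖w‖ < 2 * r + 1 := by simpa using hw
        refine (hre w).trans ?_
        gcongr) (by positivity) (by simp; linarith [norm_nonneg z]) hh0
    refine hBC.trans ?_
    rw [div_le_iff₀ (by change 0 < 2 * r + 1 - r; linarith)]
    change 2 * (M0 + K * (2 * r + 1) ^ 2) * r ≤ _ * (2 * r + 1 - r)
    have e1 : 0 ≤ M0 * r ^ 2 := by positivity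
    have e2 : 0 ≤ M0 * r ^ 3 := by positivity
    have e3 : 0 ≤ K * r ^ 2 := by positivity
    have e4 : 0 ≤ K * r ^ 3 := by positivity
    have e5 : 0 ≤ M0 * K * r ^ 2 := by positivity
    have e6 : 0 ≤ M0 * K * r ^ 3 := by positivity
    nlinarith
  have hquad := entire_eq_quadratic_of_norm_le hhd (by positivity) (by positivity) hnorm z
  have hd1 : deriv h = fun z => F' z / F z := funext fun z => (hh z).deriv
  have hd2 : iteratedDeriv 2 h 0 = F'' / F 0 - (F' 0 / F 0) ^ 2 := by
    rw [iteratedDeriv_succ, iteratedDeriv_one, hd1]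
    refine (hF'.div (hF 0) (h0 0)).deriv.trans ?_
    field_simp [h0 0]
  rw [hFe z, hquad, hd2, hd1, hh0, zero_add]

/-! ### Gaussian integrals with complex quadratic forms -/

open Matrix MatrixOrder in
/-- A positive definite and a symmetric real matrix can be diagonalized simultaneously
by a congruence. -/
theorem exists_congruence_diagonal {n : Type*} [Fintype n] [DecidableEq n] {A S : Matrix n n ℝ}
    (hA : A.PosDef) (hS : S.IsHermitian) :
    ∃ (P : Matrix n n ℝ) (l : n → ℝ), P.det ≠ 0 ∧ Pᵀ * A * P = 1 ∧ Pᵀ * S * P = diagonal l := by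
  -- With `A = BᵀB`, the matrix `B⁻¹ᵀ S B⁻¹` is symmetric; if `U` orthogonally diagonalizes it, then
  -- `P = B⁻¹ U` works.
  obtain ⟨B, hB, hAB⟩ : ∃ B : Matrix n n ℝ, IsUnit B ∧ A = Bᵀ * B := by
    obtain ⟨B, hB, h⟩ := CStarAlgebra.isStrictlyPositive_iff_eq_star_mul_self.mp
      hA.isStrictlyPositive
    exact ⟨B, hB, by simpa [star_eq_conjTranspose] using h⟩
  have hBd : IsUnit B.det := (isUnit_iff_isUnit_det B).1 hB
  have hT : (B⁻¹ᵀ * S * B⁻¹).IsHermitian := by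
    have := isHermitian_conjTranspose_mul_mul B⁻¹ hS
    simpa using this
  set U : Matrix n n ℝ := (hT.eigenvectorUnitary : Matrix n n ℝ)
  have hU : Uᵀ * U = 1 := by
    have := (Matrix.mem_unitaryGroup_iff' (A := U)).1 hT.eigenvectorUnitary.2
    simpa [star_eq_conjTranspose] using this
  have hUd : U.det ≠ 0 := by
    intro h
    have := congrArg det hU
    simp [h] at this
  refine ⟨B⁻¹ * U, hT.eigenvalues, ?_, ?_, ?_⟩
  · rw [det_mul]
    exact mul_ne_zero (by simpa [det_nonsing_inv] using hBd.ne_zero) hUd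
  · rw [hAB, transpose_mul]
    calc Uᵀ * B⁻¹ᵀ * (Bᵀ * B) * (B⁻¹ * U) = Uᵀ * ((B * B⁻¹)ᵀ * (B * B⁻¹)) * U := by
          rw [transpose_mul]; simp only [Matrix.mul_assoc]
      _ = 1 := by rw [mul_nonsing_inv _ hBd]; simpa using hU
  · have h := hT.conjStarAlgAut_star_eigenvectorUnitary
    rw [Unitary.conjStarAlgAut_apply] at h
    rw [transpose_mul]
    have h2 : Uᵀ * (B⁻¹ᵀ * S * B⁻¹) * U = diagonal hT.eigenvalues := by
      simpa [star_eq_conjTranspose] using h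
    rw [← h2]
    simp only [Matrix.mul_assoc]

open Matrix in
/-- The exponential of a complex quadratic form with positive definite real part is integrable
against exponentials of linear forms, and the integral is a Gaussian in the linear form. -/
theorem integral_cexp_neg_quadratic_add_linear {n : Type*} [Fintype n] [DecidableEq n]
    {B : Matrix n n ℂ} (hB : B.IsSymm) (hpos : (B.map re).PosDef) :
    (∀ c : n → ℂ, Integrable fun v : n → ℝ =>
      cexp (-∑ i, ∑ j, B i j * v i * v j + ∑ i, c i * v i)) ∧
    ∃ (K : ℂ) (N : Matrix n n ℂ), K ≠ 0 ∧ ∀ c : n → ℂ,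
      ∫ v : n → ℝ, cexp (-∑ i, ∑ j, B i j * v i * v j + ∑ i, c i * v i) =
        K * cexp (∑ i, ∑ j, N i j * c i * c j) := by
  have hS : (B.map im).IsHermitian := by
    ext i j
    simpa using congrArg im (hB.apply i j)
  obtain ⟨P, l, hP, hPA, hPS⟩ := exists_congruence_diagonal hpos hS
  -- Under `v = P y` the real part of the form becomes the identity and the imaginary part `diagonal
  -- l`, so the integral splits into one-dimensional Gaussians.
  set b : n → ℂ := fun k => 1 + l k * I
  have hb : ∀ k, 0 < (b k).re := by simp [b]
  have hPB : ∀ k m, ∑ i, ∑ j, (P i k : ℂ) * B i j * P j m = if k = m then b k else 0 := by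
    intro k m
    have h1 := congrFun (congrFun hPA k) m
    have h2 := congrFun (congrFun hPS k) m
    simp only [mul_apply, transpose_apply, map_apply, Finset.sum_mul, one_apply,
      diagonal_apply] at h1 h2
    rw [Finset.sum_comm] at h1 h2
    apply Complex.ext
    · simp [b, h1]
      split_ifs <;> simp
    · simp [b, h2]
      split_ifs <;> simp
  have hquad : ∀ y : n → ℝ, ∑ i, ∑ j, B i j * ((P *ᵥ y) i : ℝ) * ((P *ᵥ y) j : ℝ) =
      ∑ k, b k * (y k : ℂ) ^ 2 := by
    intro y
    have e : ∀ i j, B i j * ((P *ᵥ y) i : ℝ) * ((P *ᵥ y) j : ℝ) =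
        ∑ k, ∑ m, (P i k : ℂ) * B i j * P j m * y k * y m := by
      intro i j
      simp only [mulVec, dotProduct, ofReal_sum, ofReal_mul]
      rw [mul_assoc, Finset.sum_mul_sum, Finset.mul_sum]
      refine Finset.sum_congr rfl fun k _ => ?_
      rw [Finset.mul_sum]
      exact Finset.sum_congr rfl fun m _ => by ring
    simp_rw [e]
    calc ∑ i, ∑ j, ∑ k, ∑ m, (P i k : ℂ) * B i j * P j m * y k * y m
        = ∑ i, ∑ k, ∑ j, ∑ m, (P i k : ℂ) * B i j * P j m * y k * y m :=
          Finset.sum_congr rfl fun i _ => Finset.sum_comm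
      _ = ∑ k, ∑ i, ∑ j, ∑ m, (P i k : ℂ) * B i j * P j m * y k * y m := Finset.sum_comm
      _ = ∑ k, ∑ i, ∑ m, ∑ j, (P i k : ℂ) * B i j * P j m * y k * y m :=
          Finset.sum_congr rfl fun k _ => Finset.sum_congr rfl fun i _ => Finset.sum_comm
      _ = ∑ k, ∑ m, ∑ i, ∑ j, (P i k : ℂ) * B i j * P j m * y k * y m :=
          Finset.sum_congr rfl fun k _ => Finset.sum_comm
      _ = ∑ k, ∑ m, (∑ i, ∑ j, (P i k : ℂ) * B i j * P j m) * y k * y m := by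
          simp only [Finset.sum_mul]
      _ = _ := by simp only [hPB]; simp [pow_two, mul_assoc]
  have hlin : ∀ (c : n → ℂ) (y : n → ℝ), ∑ i, c i * ((P *ᵥ y) i : ℝ) =
      ∑ k, (∑ i, c i * P i k) * (y k : ℂ) := by
    intro c y
    simp only [mulVec, dotProduct, ofReal_sum, ofReal_mul, Finset.sum_mul, Finset.mul_sum]
    rw [Finset.sum_comm]
    simp only [mul_assoc]
  set G : (n → ℂ) → (n → ℝ) → ℂ := fun c v =>
    cexp (-∑ i, ∑ j, B i j * v i * v j + ∑ i, c i * v i)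
  have hGP : ∀ c y, G c (P *ᵥ y) =
      cexp (-∑ k, b k * (y k : ℂ) ^ 2 + ∑ k, (∑ i, c i * P i k) * (y k : ℂ)) := by
    intro c y
    simp only [G]
    rw [hquad, hlin]
  have hmap := Real.map_matrix_volume_pi_eq_smul_volume_pi hP
  have hdet : 0 < |(P.det)⁻¹| := by positivity
  have hmeas : AEMeasurable (toLin' P) (volume : Measure (n → ℝ)) :=
    (LinearMap.continuous_of_finiteDimensional _).aemeasurable
  have hGc : ∀ c, Continuous (G c) := by intro c; fun_prop
  constructor
  · intro c
    have h1 : Integrable (G c) (Measure.map (toLin' P) volume) := by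
      rw [integrable_map_measure (hGc c).aestronglyMeasurable hmeas]
      have := GaussianFourier.integrable_cexp_neg_sum_mul_add hb (fun k => ∑ i, c i * P i k)
      refine this.congr (Filter.Eventually.of_forall fun y => ?_)
      simp [hGP]
    rw [hmap] at h1
    rwa [integrable_smul_measure (by simpa using hP) (by simp)] at h1
  · refine ⟨|P.det| * ∏ k, (Real.pi / b k) ^ (1 / 2 : ℂ),
      fun i j => ∑ k, P i k * P j k / (4 * b k), ?_, ?_⟩
    · have : ∀ k, b k ≠ 0 := fun k h => by have := hb k; simp [h] at this
      refine mul_ne_zero (by simpa using hP) (Finset.prod_ne_zero_iff.2 fun k _ => ?_)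
      simp [Complex.cpow_eq_zero_iff, this, Real.pi_ne_zero]
    · intro c
      have h1 : ∫ v, G c v ∂(Measure.map (toLin' P) volume) = ∫ y, G c (P *ᵥ y) := by
        rw [integral_map hmeas (hGc c).aestronglyMeasurable]
        simp
      rw [hmap, integral_smul_measure] at h1
      simp_rw [hGP] at h1
      rw [GaussianFourier.integral_cexp_neg_sum_mul_add hb, Finset.prod_mul_distrib,
        ← Complex.exp_sum] at h1
      have h2 : ∑ k, (∑ i, c i * (P i k : ℂ)) ^ 2 / (4 * b k) =
          ∑ i, ∑ j, (∑ k, (P i k : ℂ) * P j k / (4 * b k)) * c i * c j := by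
        simp only [pow_two, Finset.sum_mul, Finset.mul_sum, Finset.sum_div]
        rw [Finset.sum_comm]
        refine Finset.sum_congr rfl fun i _ => ?_
        rw [Finset.sum_comm]
        refine Finset.sum_congr rfl fun j _ => Finset.sum_congr rfl fun k _ => ?_
        ring
      rw [h2] at h1
      change ∫ v, G c v = _
      rw [mul_assoc, ← h1, ENNReal.toReal_ofReal hdet.le, abs_inv, Complex.real_smul, ofReal_inv,
        mul_inv_cancel_left₀ (by simpa using hP)]

/-! ### Laplace transforms of Gaussian-damped functions -/

section Laplace

theorem norm_cexp_mul_ofReal_le {V : Type*} [NormedAddCommGroup V]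
    [NormedSpace ℝ V] (z : ℂ) (l : V →L[ℝ] ℝ) (t : V) :
    ‖cexp (z * l t)‖ ≤ Real.exp (‖z‖ * ‖l‖ * ‖t‖) := by
  rw [Complex.norm_exp]
  refine Real.exp_le_exp.2 ?_
  refine (Complex.re_le_norm _).trans ?_
  rw [norm_mul, Complex.norm_real, mul_assoc]
  gcongr
  exact l.le_opNorm t

variable {V : Type*} [NormedAddCommGroup V] [InnerProductSpace ℝ V] [FiniteDimensional ℝ V]
  [MeasurableSpace V] [BorelSpace V]

/-- Functions which remain integrable after multiplication with any exponential `exp (R ‖t‖)`. -/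
def ExpIntegrable (g : V → ℂ) : Prop :=
  AEStronglyMeasurable g volume ∧ ∀ R : ℝ, Integrable fun t => ‖g t‖ * Real.exp (R * ‖t‖)

theorem ExpIntegrable.integrable {g : V → ℂ} (hg : ExpIntegrable g) : Integrable g := by
  have := hg.2 0
  simp only [zero_mul, Real.exp_zero, mul_one] at this
  exact (integrable_norm_iff hg.1).1 this

theorem ExpIntegrable.mul_clm {g : V → ℂ} (hg : ExpIntegrable g) (l : V →L[ℝ] ℝ) :
    ExpIntegrable fun t => g t * l t := by
  have hm : AEStronglyMeasurable (fun t => g t * l t) volume :=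
    hg.1.mul (continuous_ofReal.comp l.continuous).aestronglyMeasurable
  refine ⟨hm, fun R => ?_⟩
  refine ((hg.2 (R + 1)).const_mul ‖l‖).mono' ?_ (Filter.Eventually.of_forall fun t => ?_)
  · exact hm.norm.mul (by fun_prop : Continuous fun t : V => Real.exp (R * ‖t‖)).aestronglyMeasurable
  · rw [Real.norm_of_nonneg (by positivity), norm_mul, Complex.norm_real]
    have h1 := l.le_opNorm t
    have h2 : ‖t‖ ≤ Real.exp ‖t‖ := (by linarith [Real.add_one_le_exp ‖t‖])
    calc ‖g t‖ * ‖l t‖ * Real.exp (R * ‖t‖)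
        ≤ ‖g t‖ * (‖l‖ * Real.exp ‖t‖) * Real.exp (R * ‖t‖) := by
          gcongr
          exact h1.trans (by gcongr)
      _ = ‖l‖ * (‖g t‖ * Real.exp ((R + 1) * ‖t‖)) := by
          rw [add_mul, one_mul, Real.exp_add]; ring

/-- The Laplace transform of a function with sufficient decay is entire along complex lines. -/
theorem ExpIntegrable.hasDerivAt_integral {g : V → ℂ} (hg : ExpIntegrable g) (l : V →L[ℝ] ℝ)
    (z : ℂ) :
    HasDerivAt (fun w : ℂ => ∫ t, g t * cexp (w * l t)) (∫ t, g t * l t * cexp (z * l t)) z := by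
  have hgl := hg.mul_clm l
  have hc : ∀ w : ℂ, Continuous fun t : V => cexp (w * l t) := fun w => by fun_prop
  refine (hasDerivAt_integral_of_dominated_loc_of_deriv_le (s := Metric.ball z 1)
    (F' := fun w t => g t * l t * cexp (w * l t))
    (bound := fun t => ‖g t * l t‖ * Real.exp ((‖z‖ + 1) * ‖l‖ * ‖t‖))
    (Metric.ball_mem_nhds z one_pos) (Filter.Eventually.of_forall fun w =>
      hg.1.mul (hc w).aestronglyMeasurable) ?_ (hgl.1.mul (hc z).aestronglyMeasurable) ?_
    (hgl.2 _) ?_).2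
  · refine (hg.2 (‖z‖ * ‖l‖)).mono' (hg.1.mul (hc z).aestronglyMeasurable)
      (Filter.Eventually.of_forall fun t => ?_)
    rw [Pi.mul_apply, norm_mul]
    gcongr
    exact norm_cexp_mul_ofReal_le z l t
  · refine Filter.Eventually.of_forall fun t w hw => ?_
    rw [norm_mul]
    gcongr
    refine (norm_cexp_mul_ofReal_le w l t).trans (Real.exp_le_exp.2 ?_)
    gcongr
    have : ‖w - z‖ < 1 := by simpa [dist_eq_norm] using hw
    linarith [norm_le_norm_add_norm_sub' w z]
  · refine Filter.Eventually.of_forall fun t w _ => ?_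
    refine ((((hasDerivAt_id w).mul_const ((l t : ℝ) : ℂ)).cexp).const_mul (g t)).congr_deriv ?_
    simp only [id]
    ring

/-- A square integrable function times a Gaussian has all exponential moments. -/
theorem integrable_mul_gaussian_mul_exp {f : V → ℂ} (hf : MemLp f 2 volume) {a : ℝ} (ha : 0 < a)
    (R : ℝ) : Integrable fun t => ‖f t‖ * (Real.exp (-a * ‖t‖ ^ 2) * Real.exp (R * ‖t‖)) := by
  have hG : MemLp (fun t : V => Real.exp (-a * ‖t‖ ^ 2) * Real.exp (R * ‖t‖)) 2 volume := by
    have hc : Continuous fun t : V => Real.exp (-a * ‖t‖ ^ 2) * Real.exp (R * ‖t‖) := by fun_prop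
    rw [memLp_two_iff_integrable_sq hc.aestronglyMeasurable]
    have h1 := (GaussianFourier.integrable_cexp_neg_mul_sq_norm_add (V := V) (b := (a : ℂ))
      (by simpa using ha) 0 0).norm
    refine (h1.const_mul (Real.exp (R ^ 2 / a))).mono' (hc.pow 2).aestronglyMeasurable
      (Filter.Eventually.of_forall fun t => ?_)
    rw [Real.norm_of_nonneg (by positivity), Complex.norm_exp, ← Real.exp_add, ← Real.exp_add,
      ← Real.exp_nat_mul]
    refine Real.exp_le_exp.2 ?_
    have hre : (-(a : ℂ) * (‖t‖ : ℂ) ^ 2 + 0 * ((inner ℝ (0 : V) t : ℝ) : ℂ)).re =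
        -a * ‖t‖ ^ 2 := by
      rw [zero_mul, add_zero]
      norm_cast
    rw [hre, div_add' _ _ _ ha.ne', le_div_iff₀ ha]
    push_cast
    nlinarith [sq_nonneg (R - a * ‖t‖)]
  exact MemLp.integrable_mul hf.norm hG

theorem expIntegrable_mul_gaussian {f : V → ℂ} (hf : MemLp f 2 volume) {a : ℝ} (ha : 0 < a) :
    ExpIntegrable fun t => f t * Real.exp (-a * ‖t‖ ^ 2) := by
  refine ⟨hf.1.mul (by fun_prop : Continuous fun t : V =>
    ((Real.exp (-a * ‖t‖ ^ 2) : ℝ) : ℂ)).aestronglyMeasurable, fun R => ?_⟩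
  refine (integrable_mul_gaussian_mul_exp hf ha R).congr (Filter.Eventually.of_forall fun t => ?_)
  simp only [norm_mul, Complex.norm_real, Real.norm_eq_abs, Real.abs_exp]
  ring

/-- The Laplace transform of a square integrable function times a Gaussian has order two. -/
theorem norm_laplace_gaussian_le {f : V → ℂ} (hf : MemLp f 2 volume) {a : ℝ} (ha : 0 < a)
    (l : V →L[ℝ] ℝ) (z : ℂ) :
    ‖∫ t, f t * Real.exp (-a * ‖t‖ ^ 2) * cexp (z * l t)‖ ≤
      (∫ t, ‖f t‖ * (Real.exp (-(a / 2) * ‖t‖ ^ 2) * Real.exp (0 * ‖t‖))) *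
        Real.exp (‖l‖ ^ 2 / (2 * a) * ‖z‖ ^ 2) := by
  rw [← integral_mul_const]
  refine norm_integral_le_of_norm_le
    ((integrable_mul_gaussian_mul_exp hf (half_pos ha) 0).mul_const _)
    (Filter.Eventually.of_forall fun t => ?_)
  rw [norm_mul, norm_mul, mul_assoc, mul_assoc, Complex.norm_real, Real.norm_eq_abs, Real.abs_exp]
  gcongr ‖f t‖ * ?_
  calc Real.exp (-a * ‖t‖ ^ 2) * ‖cexp (z * l t)‖
      ≤ Real.exp (-a * ‖t‖ ^ 2) * Real.exp (‖z‖ * ‖l‖ * ‖t‖) := by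
        gcongr
        exact norm_cexp_mul_ofReal_le z l t
    _ ≤ _ := by
        rw [← Real.exp_add, ← Real.exp_add, ← Real.exp_add]
        refine Real.exp_le_exp.2 ?_
        -- Half of the Gaussian absorbs the exponential; the other half keeps the integral finite.
        have : ‖z‖ * ‖l‖ * ‖t‖ ≤ a / 2 * ‖t‖ ^ 2 + ‖l‖ ^ 2 / (2 * a) * ‖z‖ ^ 2 := by
          have e : a / 2 * ‖t‖ ^ 2 + ‖l‖ ^ 2 / (2 * a) * ‖z‖ ^ 2 - ‖z‖ * ‖l‖ * ‖t‖ =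
              (a * ‖t‖ - ‖l‖ * ‖z‖) ^ 2 / (2 * a) := by
            field_simp
            ring
          have : 0 ≤ (a * ‖t‖ - ‖l‖ * ‖z‖) ^ 2 / (2 * a) := by positivity
          linarith
        linarith

end Laplace

/-! ### Reality, continuity and sign of the Wigner distribution -/

section Wigner

variable {d : ℕ} {f : EuclideanSpace ℝ (Fin d) → ℂ}

local notation "E" => EuclideanSpace ℝ (Fin d)

/-- The function of `t` whose Fourier transform is the Wigner distribution at `x`. -/
def wignerKernel (f : E → ℂ) (x t : E) : ℂ :=
  f (x + (1 / 2 : ℝ) • t) * (starRingEnd ℂ) (f (x - (1 / 2 : ℝ) • t))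

theorem wigner_eq_fourier (f : E → ℂ) (x ξ : E) :
    wigner f f x ξ = 𝓕 (wignerKernel f x) ξ := by
  rw [Real.fourier_eq', wigner]
  refine integral_congr_ae (Filter.Eventually.of_forall fun t => ?_)
  simp only [wignerKernel, smul_eq_mul]
  rw [mul_comm, real_inner_comm]
  push_cast
  ring_nf

theorem integrable_wignerKernel (hf : MemLp f 2 volume) (x : E) :
    Integrable (wignerKernel f x) := by
  have h1 : MemLp (fun s => f (x + s)) 2 volume :=
    hf.comp_measurePreserving (measurePreserving_add_left volume x)
  have h2 : MemLp (fun s => (starRingEnd ℂ) (f (x - s))) 2 volume :=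
    (hf.comp_measurePreserving (Measure.measurePreserving_sub_left volume x)).star
  exact (MemLp.integrable_mul h1 h2).comp_smul (R := (1 / 2 : ℝ)) (by norm_num)

/-- The substitution `t ↦ -t` exchanges the two factors and undoes the conjugation. -/
theorem conj_wigner (f : E → ℂ) (x ξ : E) :
    (starRingEnd ℂ) (wigner f f x ξ) = wigner f f x ξ := by
  rw [wigner, ← integral_conj, ← integral_neg_eq_self]
  refine integral_congr_ae (Filter.Eventually.of_forall fun t => ?_)
  simp only [map_mul, Complex.conj_conj, ← Complex.exp_conj, map_neg, conj_ofReal, conj_I,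
    smul_neg, inner_neg_right, ofReal_neg, map_ofNat, sub_neg_eq_add, ← sub_eq_add_neg]
  ring_nf

theorem ofReal_re_wigner (f : E → ℂ) (x ξ : E) :
    (((wigner f f x ξ).re : ℝ) : ℂ) = wigner f f x ξ :=
  Complex.conj_eq_iff_re.1 (conj_wigner f x ξ)

theorem continuous_wigner_right (hf : MemLp f 2 volume) (x : E) :
    Continuous fun ξ => wigner f f x ξ := by
  simp_rw [wigner_eq_fourier]
  exact VectorFourier.fourierIntegral_continuous Real.continuous_fourierChar
    continuous_inner (integrable_wignerKernel hf x)

theorem wigner_zero_right (f : E → ℂ) (x : E) :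
    wigner f f x 0 = (2 : ℝ) ^ d * ∫ s, f s * (starRingEnd ℂ) (f ((2 : ℝ) • x - s)) := by
  have h1 : wigner f f x 0 = ∫ t : E, (fun s => f (x + s) * (starRingEnd ℂ) (f (x - s)))
      ((1 / 2 : ℝ) • t) := by
    rw [wigner]
    simp
  rw [h1, Measure.integral_comp_smul volume (fun s => f (x + s) * (starRingEnd ℂ) (f (x - s))),
    ← integral_add_left_eq_self (fun s => f s * (starRingEnd ℂ) (f ((2 : ℝ) • x - s))) x]
  have h2 : ∀ s : E, (2 : ℝ) • x - (x + s) = x - s := fun s => by rw [two_smul]; abel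
  simp_rw [h2]
  simp

/-- Up to `2^d` this is the `L²` inner product of `conj f` with its composition with `s ↦ 2x - s`,
and such compositions depend continuously on `x` in `L²`. -/
theorem continuous_wigner_zero_right (hf : MemLp f 2 volume) :
    Continuous fun x => wigner f f x 0 := by
  simp_rw [wigner_zero_right]
  refine continuous_const.mul ?_
  have hmp : ∀ x : E, MeasurePreserving (fun s : E => (2 : ℝ) • x - s) volume volume :=
    fun x => Measure.measurePreserving_sub_left volume _
  let G : E → C(E, E) := fun x => ⟨fun s => (2 : ℝ) • x - s, by fun_prop⟩
  have hG : Continuous G :=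
    ContinuousMap.continuous_of_continuous_uncurry _ (by
      simp only [G, Function.uncurry_def, ContinuousMap.coe_mk]
      fun_prop)
  have hstar : MemLp (fun s => (starRingEnd ℂ) (f s)) 2 volume := hf.star
  have hcont : Continuous fun x => Lp.compMeasurePreserving (G x) (hmp x) (hstar.toLp) :=
    continuous_const.compMeasurePreservingLp hG hmp (by simp)
  have hin : Continuous fun x : E => inner ℂ hstar.toLp
      (Lp.compMeasurePreserving (G x) (hmp x) (hstar.toLp)) :=
    continuous_const.inner hcont
  refine hin.congr fun x => ?_
  rw [L2.inner_def]
  refine integral_congr_ae ?_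
  have h1 := hstar.coeFn_toLp
  have h2 := Lp.coeFn_compMeasurePreserving hstar.toLp (hmp x)
  have h3 := (hmp x).quasiMeasurePreserving.ae_eq_comp h1
  filter_upwards [h1, h2, h3] with s e1 e2 e3
  rw [show Lp.compMeasurePreserving (G x) (hmp x) hstar.toLp s = _ from e2.trans e3, e1]
  simp [mul_comm]

theorem mul_pos_of_continuous_of_ne_zero {X : Type*} [TopologicalSpace X] [PreconnectedSpace X]
    {g : X → ℝ} (hg : Continuous g) (h0 : ∀ x, g x ≠ 0) (a b : X) : 0 < g a * g b := by
  by_contra h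
  have : (0 : ℝ) ∈ Set.uIcc (g a) (g b) := by
    rw [Set.mem_uIcc]
    rcases lt_or_gt_of_ne (h0 a) with ha | ha <;> rcases lt_or_gt_of_ne (h0 b) with hb | hb
    · exact absurd (mul_pos_of_neg_of_neg ha hb) h
    · exact Or.inl ⟨ha.le, hb.le⟩
    · exact Or.inr ⟨hb.le, ha.le⟩
    · exact absurd (mul_pos ha hb) h
  obtain ⟨x, hx⟩ := mem_range_of_exists_le_of_exists_ge (c := 0) hg
    (by rcases Set.mem_uIcc.1 this with h | h
        exacts [⟨a, h.1⟩, ⟨b, h.1⟩])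
    (by rcases Set.mem_uIcc.1 this with h | h
        exacts [⟨b, h.2⟩, ⟨a, h.2⟩])
  exact h0 x hx

/-- A Wigner distribution without zeros has constant sign. -/
theorem exists_sign_wigner (hf : MemLp f 2 volume) (h0 : ∀ x ξ : E, wigner f f x ξ ≠ 0) :
    ∃ σ : ℝ, ∀ x ξ : E, 0 < σ * (wigner f f x ξ).re := by
  have hre : ∀ x ξ : E, (wigner f f x ξ).re ≠ 0 := by
    intro x ξ h
    apply h0 x ξ
    rw [← ofReal_re_wigner, h, ofReal_zero]
  -- Joint continuity is not needed: go from `(0,0)` to `(x,0)`, then to `(x,ξ)`.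
  refine ⟨(wigner f f 0 0).re, fun x ξ => ?_⟩
  have h1 := mul_pos_of_continuous_of_ne_zero
    (continuous_re.comp (continuous_wigner_zero_right hf)) (fun x => hre x 0) 0 x
  have h2 := mul_pos_of_continuous_of_ne_zero
    (continuous_re.comp (continuous_wigner_right hf x)) (fun ξ => hre x ξ) 0 ξ
  simp only [Function.comp_apply] at h1 h2
  have h3 := mul_pos h1 h2
  have h4 : 0 < (wigner f f x 0).re ^ 2 := by have := hre x 0; positivity
  nlinarith [pos_of_mul_pos_right (a := (wigner f f x 0).re ^ 2)
    (b := (wigner f f 0 0).re * (wigner f f x ξ).re) (by linarith) h4.le]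

/-- The Wigner distribution in terms of the short-time Fourier transform. -/
theorem wigner_eq_stft_reflection (f : E → ℂ) (x ξ : E) :
    wigner f f x ξ = (2 : ℝ) ^ d * cexp (4 * Real.pi * I * (inner ℝ ξ x : ℝ)) *
      stft (reflection f) f ((2 : ℝ) • x) ((2 : ℝ) • ξ) := by
  -- The integrand after the substitution `s = x + t/2`, whose Jacobian is the factor `2^d`.
  set H : E → ℂ := fun s => f s * (starRingEnd ℂ) (f ((2 : ℝ) • x - s)) *
    cexp (-4 * Real.pi * I * (inner ℝ ξ (s - x) : ℝ))
  have h1 : wigner f f x ξ = ∫ t : E, (fun s => H (x + s)) ((1 / 2 : ℝ) • t) := by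
    rw [wigner]
    refine integral_congr_ae (Filter.Eventually.of_forall fun t => ?_)
    simp only [H]
    have h2 : (2 : ℝ) • x - (x + (1 / 2 : ℝ) • t) = x - (1 / 2 : ℝ) • t := by
      rw [two_smul]; abel
    rw [h2, add_sub_cancel_left, inner_smul_right]
    push_cast
    ring_nf
  rw [h1, Measure.integral_comp_smul volume (fun s => H (x + s)), integral_add_left_eq_self H x, stft, mul_assoc,
    ← integral_const_mul]
  have h3 : ∀ s : E, cexp (4 * Real.pi * I * (inner ℝ ξ x : ℝ)) * (f s *
      (starRingEnd ℂ) (reflection f (s - (2 : ℝ) • x)) *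
      cexp (-2 * Real.pi * I * (inner ℝ ((2 : ℝ) • ξ) s : ℝ))) = H s := by
    intro s
    simp only [H, reflection, neg_sub, inner_sub_right, inner_smul_left]
    have : cexp (-4 * Real.pi * I * ((inner ℝ ξ s - inner ℝ ξ x : ℝ) : ℂ)) =
      cexp (4 * Real.pi * I * (inner ℝ ξ x : ℝ)) *
        cexp (-2 * Real.pi * I * ((starRingEnd ℝ 2 * inner ℝ ξ s : ℝ) : ℂ)) := by
      rw [← Complex.exp_add]
      simp only [conj_trivial]
      push_cast
      ring_nf
    rw [this]
    ring
  simp_rw [h3]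
  simp

end Wigner

/-! ### Positivity of Gaussian averages and the midpoint change of variables -/

theorem integral_pos_of_forall_pos {X : Type*} [MeasurableSpace X] {μ : Measure X} [NeZero μ]
    {g : X → ℝ} (hg : Integrable g μ) (hpos : ∀ x, 0 < g x) : 0 < ∫ x, g x ∂μ := by
  rw [integral_pos_iff_support_of_nonneg (fun x => (hpos x).le) hg,
    Function.support_eq_univ fun x => (hpos x).ne']
  exact Measure.measure_univ_pos.2 (NeZero.ne μ)

section General

variable {V : Type*} [NormedAddCommGroup V] [InnerProductSpace ℝ V] [FiniteDimensional ℝ V]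
  [MeasurableSpace V] [BorelSpace V]

theorem integral_fourier_mul_eq {p q : V → ℂ} (hp : Integrable p) (hq : Integrable q) :
    ∫ ξ, 𝓕 p ξ * q ξ = ∫ t, p t * 𝓕 q t := by
  have := VectorFourier.integral_fourierIntegral_smul_eq_flip (L := innerₗ V)
    Real.continuous_fourierChar continuous_inner hp hq
  simp only [flip_innerₗ, smul_eq_mul] at this
  exact this

theorem fourier_mul_cexp_inner (p : V → ℂ) (v ξ : V) :
    𝓕 (fun t => p t * cexp (2 * Real.pi * I * (inner ℝ v t : ℝ))) ξ = 𝓕 p (ξ - v) := by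
  rw [Real.fourier_eq', Real.fourier_eq']
  refine integral_congr_ae (Filter.Eventually.of_forall fun t => ?_)
  simp only [smul_eq_mul]
  rw [mul_comm (p t), ← mul_assoc, ← Complex.exp_add]
  congr 2
  rw [inner_sub_right, real_inner_comm t v]
  push_cast
  ring

/-- If the Fourier transform of `p` has real part of constant sign, so have the integrals of `p`
against modulated Gaussians. -/
theorem integral_mul_gaussian_pos_of_fourier_pos {p : V → ℂ} (hp : Integrable p) {σ : ℝ}
    (hσ : ∀ ξ, 0 < σ * (𝓕 p ξ).re) (v : V) :
    0 < σ * (∫ t, p t * cexp (2 * Real.pi * I * (inner ℝ v t : ℝ)) *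
      cexp (-(Real.pi / 2) * ‖t‖ ^ 2)).re := by
  set p' : V → ℂ := fun t => p t * cexp (2 * Real.pi * I * (inner ℝ v t : ℝ))
  have hp' : Integrable p' := by
    refine hp.mono (hp.1.mul (by fun_prop : Continuous fun t : V =>
      cexp (2 * Real.pi * I * (inner ℝ v t : ℝ))).aestronglyMeasurable)
      (Filter.Eventually.of_forall fun t => ?_)
    simp [p', Complex.norm_exp]
  have h2pi : (0 : ℝ) < ((2 * Real.pi : ℝ) : ℂ).re := by
    rw [ofReal_re]; positivity
  -- The width is chosen so that `𝓕 q` is a positive multiple of `exp(-(π/2)‖t‖²)`.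
  set q : V → ℂ := fun η => cexp (-((2 * Real.pi : ℝ) : ℂ) * ‖η‖ ^ 2)
  have hq : Integrable q := by
    have := GaussianFourier.integrable_cexp_neg_mul_sq_norm_add (V := V) h2pi 0 0
    simpa only [zero_mul, add_zero] using this
  set c : ℝ := (1 / 2 : ℝ) ^ ((Module.finrank ℝ V : ℝ) / 2)
  have hc : 0 < c := by positivity
  have hqF : ∀ t, 𝓕 q t = c * cexp (-(Real.pi / 2) * ‖t‖ ^ 2) := by
    intro t
    rw [fourier_gaussian_innerProductSpace h2pi]
    have hpi : (Real.pi : ℂ) ≠ 0 := by exact_mod_cast Real.pi_ne_zero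
    congr 1
    · have : (Real.pi : ℂ) / ((2 * Real.pi : ℝ) : ℂ) = ((1 / 2 : ℝ) : ℂ) := by
        push_cast
        field_simp
      rw [this]
      simp only [c]
      rw [ofReal_cpow (by norm_num)]
      push_cast
      rfl
    · congr 1
      push_cast
      field_simp
  have key := integral_fourier_mul_eq hp' hq
  simp_rw [hqF] at key
  have e1 : ∫ t, p' t * (c * cexp (-(Real.pi / 2) * ‖t‖ ^ 2)) =
      c * ∫ t, p' t * cexp (-(Real.pi / 2) * ‖t‖ ^ 2) := by
    rw [← integral_const_mul]
    refine integral_congr_ae (Filter.Eventually.of_forall fun t => ?_)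
    ring
  rw [e1] at key
  have hFq : Integrable fun ξ => 𝓕 p' ξ * q ξ := by
    have hcont : Continuous (𝓕 p') :=
      VectorFourier.fourierIntegral_continuous Real.continuous_fourierChar continuous_inner hp'
    refine hq.bdd_mul (c := ∫ t, ‖p' t‖) hcont.aestronglyMeasurable
      (Filter.Eventually.of_forall fun ξ => ?_)
    exact VectorFourier.norm_fourierIntegral_le_integral_norm _ _ _ _ _
  -- Modulating `p` only translates its Fourier transform, so the sign hypothesis still applies.
  have hpos : 0 < ∫ ξ, σ * (𝓕 p' ξ * q ξ).re := by
    refine integral_pos_of_forall_pos (hFq.re.const_mul σ) fun ξ => ?_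
    have hqr : q ξ = ((Real.exp (-(2 * Real.pi) * ‖ξ‖ ^ 2) : ℝ) : ℂ) := by
      simp only [q]; push_cast; rfl
    rw [hqr, re_mul_ofReal, ← mul_assoc, fourier_mul_cexp_inner]
    exact mul_pos (hσ _) (Real.exp_pos _)
  rw [integral_const_mul] at hpos
  have hre : ∫ ξ, (𝓕 p' ξ * q ξ).re = (∫ ξ, 𝓕 p' ξ * q ξ).re := integral_re hFq
  rw [hre, key, re_ofReal_mul] at hpos
  refine pos_of_mul_pos_right (a := c) ?_ hc.le
  linarith

/-- The change of variables `(x, t) ↦ (x + t / 2, x - t / 2)` preserves volume. -/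
theorem measurePreserving_add_half_sub_half :
    MeasurePreserving (fun z : V × V => (z.1 + (1 / 2 : ℝ) • z.2, z.1 - (1 / 2 : ℝ) • z.2))
      (volume.prod volume) (volume.prod volume) := by
  -- The map is a composite of shears, swaps and a reflection in one variable: `(x,t) ↦ (x + t/2, t)
  -- ↦ (x + t/2, x - t/2)`.
  have h1 : MeasurePreserving (fun z : V × V => (z.1, z.2 + (1 / 2 : ℝ) • z.1))
      (volume.prod volume) (volume.prod volume) :=
    (MeasurePreserving.id _).skew_product (g := fun t x => x + (1 / 2 : ℝ) • t)
      (by fun_prop) (Filter.Eventually.of_forall fun t =>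
        (measurePreserving_add_right volume ((1 / 2 : ℝ) • t)).map_eq)
  have h2 : MeasurePreserving (fun z : V × V => (z.1, z.1 - z.2))
      (volume.prod volume) (volume.prod volume) :=
    (MeasurePreserving.id _).skew_product (g := fun s t => s - t)
      (by fun_prop) (Filter.Eventually.of_forall fun s =>
        (Measure.measurePreserving_sub_left volume s).map_eq)
  have h3 := h2.comp (Measure.measurePreserving_swap.comp (h1.comp Measure.measurePreserving_swap))
  convert h3 using 1
  funext z
  simp only [Function.comp_apply, Prod.swap, Prod.mk.injEq, true_and]
  module

end General

/-! ### Absence of zeros of the Laplace transform -/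

section Wigner

variable {d : ℕ} {f : EuclideanSpace ℝ (Fin d) → ℂ}

local notation "E" => EuclideanSpace ℝ (Fin d)

/-- If the Wigner distribution has constant sign, then the Laplace transform of `f` times a
Gaussian has no zeros. -/
theorem integral_mul_gaussian_ne_zero (hf : MemLp f 2 volume) {σ : ℝ}
    (hσ : ∀ x ξ : E, 0 < σ * (wigner f f x ξ).re) (ξ : E) (z : ℂ) :
    ∫ t : E, f t * Real.exp (-Real.pi * ‖t‖ ^ 2) *
      cexp (z * ((2 * Real.pi * inner ℝ ξ t : ℝ) : ℂ)) ≠ 0 := by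
  intro hzero
  set k : E → ℂ := fun t => f t * Real.exp (-Real.pi * ‖t‖ ^ 2) *
    cexp (z * ((2 * Real.pi * inner ℝ ξ t : ℝ) : ℂ))
  have hk : Integrable k := by
    have hg := expIntegrable_mul_gaussian hf Real.pi_pos
    set l : E →L[ℝ] ℝ := (2 * Real.pi) • innerSL ℝ ξ
    have hkl : k = fun t => f t * Real.exp (-Real.pi * ‖t‖ ^ 2) * cexp (z * l t) := by
      funext t
      simp [k, l]
    rw [hkl]
    refine (hg.2 (‖z‖ * ‖l‖)).mono' (hg.1.mul (by fun_prop : Continuous fun t : E =>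
      cexp (z * l t)).aestronglyMeasurable) (Filter.Eventually.of_forall fun t => ?_)
    rw [norm_mul]
    gcongr
    exact norm_cexp_mul_ofReal_le z l t
  have hkk : Integrable (fun y : E × E => k y.1 * (starRingEnd ℂ) (k y.2))
      (volume.prod volume) :=
    hk.mul_prod (Complex.conjLIE.integrable_comp_iff.2 hk)
  have hT := measurePreserving_add_half_sub_half (V := E)
  -- The integral of `H` is `|∫ k|²` in midpoint and difference variables, hence zero by assumption.
  set H : E × E → ℂ := fun y =>
    k (y.1 + (1 / 2 : ℝ) • y.2) * (starRingEnd ℂ) (k (y.1 - (1 / 2 : ℝ) • y.2))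
  have hH : Integrable H (volume.prod volume) := hT.integrable_comp_of_integrable hkk
  have hH0 : ∫ y, H y ∂(volume.prod volume) = 0 := by
    have h1 := integral_map hT.measurable.aemeasurable (hT.map_eq.symm ▸ hkk.1)
    rw [hT.map_eq, integral_prod_mul k (fun t => (starRingEnd ℂ) (k t)), hzero, zero_mul] at h1
    exact h1.symm
  rw [integral_prod _ hH] at hH0
  -- By the parallelogram law the Gaussians separate into `x` and `t`. The real part of `z` enters
  -- only this positive weight, the imaginary part only a modulation in `t`.
  set w : E → ℝ := fun x =>
    Real.exp (-2 * Real.pi * ‖x‖ ^ 2 + 4 * Real.pi * z.re * inner ℝ ξ x)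
  have hHx : ∀ x t, H (x, t) = w x * (wignerKernel f x t *
      cexp (2 * Real.pi * I * (inner ℝ (z.im • ξ) t : ℝ)) *
      cexp (-(Real.pi / 2) * ‖t‖ ^ 2)) := by
    intro x t
    have hpar : ‖x + (1 / 2 : ℝ) • t‖ ^ 2 + ‖x - (1 / 2 : ℝ) • t‖ ^ 2 =
        2 * ‖x‖ ^ 2 + ‖t‖ ^ 2 / 2 := by
      rw [norm_add_sq_real, norm_sub_sq_real, norm_smul]
      norm_num
      ring
    have hparC : -(Real.pi : ℂ) * (‖x + (1 / 2 : ℝ) • t‖ : ℂ) ^ 2 +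
        -(Real.pi : ℂ) * (‖x - (1 / 2 : ℝ) • t‖ : ℂ) ^ 2 =
        -2 * (Real.pi : ℂ) * (‖x‖ : ℂ) ^ 2 + -((Real.pi : ℂ) / 2) * (‖t‖ : ℂ) ^ 2 := by
      have := congrArg (fun r : ℝ => -(Real.pi : ℂ) * (r : ℂ)) hpar
      push_cast at this
      linear_combination this
    have hexp : cexp (-(Real.pi : ℂ) * (‖x + (1 / 2 : ℝ) • t‖ : ℂ) ^ 2) *
        cexp (z * ((2 * Real.pi * inner ℝ ξ (x + (1 / 2 : ℝ) • t) : ℝ) : ℂ)) *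
        (cexp (-(Real.pi : ℂ) * (‖x - (1 / 2 : ℝ) • t‖ : ℂ) ^ 2) *
        cexp ((starRingEnd ℂ) z * ((2 * Real.pi * inner ℝ ξ (x - (1 / 2 : ℝ) • t) : ℝ) : ℂ))) =
        w x * (cexp (2 * Real.pi * I * (inner ℝ (z.im • ξ) t : ℝ)) *
          cexp (-(Real.pi / 2) * ‖t‖ ^ 2)) := by
      simp only [w, ofReal_exp]
      simp only [← Complex.exp_add]
      congr 1
      rw [inner_add_right, inner_sub_right, inner_smul_right, inner_smul_left]
      have hz : (starRingEnd ℂ) z = z.re - z.im * I := by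
        apply Complex.ext <;> simp
      rw [hz]
      nth_rewrite 1 [← Complex.re_add_im z]
      simp only [conj_trivial]
      push_cast at hparC ⊢
      linear_combination hparC
    simp only [H, k, wignerKernel, map_mul, ← Complex.exp_conj, conj_ofReal]
    push_cast at hexp ⊢
    linear_combination (f (x + (1 / 2 : ℝ) • t) * (starRingEnd ℂ) (f (x - (1 / 2 : ℝ) • t))) * hexp
  have hpos : 0 < ∫ x : E, σ * (∫ t : E, H (x, t)).re := by
    refine integral_pos_of_forall_pos (hH.integral_prod_left.re.const_mul σ) fun x => ?_
    simp_rw [hHx]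
    rw [integral_const_mul, re_ofReal_mul, mul_left_comm]
    refine mul_pos (Real.exp_pos _)
      (integral_mul_gaussian_pos_of_fourier_pos (integrable_wignerKernel hf x) ?_ _)
    intro η
    rw [← wigner_eq_fourier]
    exact hσ x η
  rw [integral_const_mul] at hpos
  have hre : ∫ x : E, (∫ t : E, H (x, t)).re = (∫ x : E, ∫ t : E, H (x, t)).re :=
    integral_re hH.integral_prod_left
  rw [hre, hH0] at hpos
  simp at hpos

end Wigner

/-! ### Fourier inversion almost everywhere -/

section General

variable {V : Type*} [NormedAddCommGroup V] [InnerProductSpace ℝ V] [FiniteDimensional ℝ V]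
  [MeasurableSpace V] [BorelSpace V]

open scoped SchwartzMap in
/-- Fourier inversion almost everywhere. -/
theorem ae_eq_fourierInv_fourier {g : V → ℂ} (hg : Integrable g) (hFg : Integrable (𝓕 g)) :
    g =ᵐ[volume] 𝓕⁻ (𝓕 g) := by
  have hneg : Integrable fun t => 𝓕 g (-t) := hFg.comp_neg
  have hcont : Continuous (𝓕⁻ (𝓕 g)) := by
    rw [Real.fourierInv_eq_fourier_comp_neg]
    exact VectorFourier.fourierIntegral_continuous Real.continuous_fourierChar continuous_inner hneg
  -- Testing against smooth compactly supported functions moves the inversion onto Schwartz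
  -- functions, so `g` need not be continuous.
  refine ae_eq_of_integral_contDiff_smul_eq hg.locallyIntegrable hcont.locallyIntegrable
    fun ψ hψ hψs => ?_
  have hs : HasCompactSupport fun t => (ψ t : ℂ) := hψs.comp_left ofReal_zero
  set Ψ : 𝓢(V, ℂ) := hs.toSchwartzMap (ofRealCLM.contDiff.comp hψ)
  have hΨ : ∀ t, Ψ t = ψ t := fun t => rfl
  set φ : 𝓢(V, ℂ) := 𝓕⁻ Ψ
  have hφ : 𝓕 (φ : V → ℂ) = Ψ := by
    rw [← SchwartzMap.fourier_coe]
    simp [φ]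
  have h1 : ∫ t, ψ t • g t = ∫ t, 𝓕 g t * φ t := by
    rw [integral_fourier_mul_eq hg φ.integrable, hφ]
    simp [hΨ, mul_comm]
  have h2 : ∫ t, ψ t • 𝓕⁻ (𝓕 g) t = ∫ t, 𝓕 g t * φ t := by
    have h3 : ∀ t, 𝓕 g t * φ t = (fun t => 𝓕 g (-t) * 𝓕 (Ψ : V → ℂ) t) (-t) := by
      intro t
      simp only [neg_neg, φ]
      rw [SchwartzMap.fourierInv_coe, Real.fourierInv_eq_fourier_neg]
    rw [integral_congr_ae (Filter.Eventually.of_forall h3),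
      integral_neg_eq_self (fun t => 𝓕 g (-t) * 𝓕 (Ψ : V → ℂ) t), ← integral_fourier_mul_eq hneg Ψ.integrable,
      ← Real.fourierInv_eq_fourier_comp_neg]
    simp [hΨ, mul_comm]
  rw [h1, h2]

end General

/-! ### Functions with a Gaussian Fourier transform -/

section Euclidean

variable {d : ℕ}

local notation "E" => EuclideanSpace ℝ (Fin d)

/-- By the Riemann-Lebesgue lemma, a Gaussian which is a Fourier transform of an integrable
function decays. -/
theorem posDef_of_fourier_eq_cexp {g : E → ℂ} {F0 : ℂ} (hF0 : F0 ≠ 0)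
    {B : Matrix (Fin d) (Fin d) ℂ} (hB : B.IsSymm) {c : Fin d → ℂ}
    (h : ∀ ξ : E, 𝓕 g ξ = F0 * cexp (-∑ i, ∑ j, B i j * ξ i * ξ j + ∑ i, c i * ξ i)) :
    (B.map re).PosDef := by
  refine Matrix.PosDef.of_dotProduct_mulVec_pos ?_ fun v hv => ?_
  · ext i j
    simpa using congrArg re (hB.apply i j)
  set b : ℂ := ∑ i, ∑ j, B i j * v i * v j
  have hb : star v ⬝ᵥ (B.map re).mulVec v = b.re := by
    simp only [b, dotProduct, Matrix.mulVec, Finset.mul_sum, re_sum, re_mul_ofReal,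
      Matrix.map_apply, star_trivial]
    exact Finset.sum_congr rfl fun i _ => Finset.sum_congr rfl fun j _ => by ring
  rw [hb]
  by_contra hneg
  push Not at hneg
  set w : E := WithLp.toLp 2 v
  have hw : w ≠ 0 := by
    simpa [w] using hv
  have hRL : Filter.Tendsto (𝓕 g) (Filter.cocompact E) (nhds 0) :=
    tendsto_integral_exp_inner_smul_cocompact g
  have hco : Filter.Tendsto (fun s : ℝ => s • w) Filter.atTop (Filter.cocompact E) := by
    rw [← Metric.cobounded_eq_cocompact, ← tendsto_norm_atTop_iff_cobounded]
    simp_rw [norm_smul]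
    exact Filter.tendsto_abs_atTop_atTop.atTop_mul_const (norm_pos_iff.2 hw)
  have hco' : Filter.Tendsto (fun s : ℝ => s • (-w)) Filter.atTop (Filter.cocompact E) := by
    rw [← Metric.cobounded_eq_cocompact, ← tendsto_norm_atTop_iff_cobounded]
    simp_rw [norm_smul, norm_neg]
    exact Filter.tendsto_abs_atTop_atTop.atTop_mul_const (norm_pos_iff.2 hw)
  -- In the product over the opposite points `±s w` the linear terms cancel, leaving modulus `‖F0‖²
  -- exp(-2s² Re b)`, which cannot tend to `0` if `Re b ≤ 0`.
  have hlim := ((hRL.comp hco).mul (hRL.comp hco')).norm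
  simp only [Function.comp_def, mul_zero, norm_zero] at hlim
  have hge : ∀ s : ℝ, ‖F0‖ ^ 2 ≤ ‖𝓕 g (s • w) * 𝓕 g (s • (-w))‖ := by
    intro s
    have e1 : ∀ r : ℝ, ∑ i, ∑ j, B i j * ((r • w) i : ℝ) * ((r • w) j : ℝ) = r ^ 2 * b := by
      intro r
      simp only [b, Finset.mul_sum, w, PiLp.smul_apply, smul_eq_mul, ofReal_mul]
      exact Finset.sum_congr rfl fun i _ => Finset.sum_congr rfl fun j _ => by ring
    have e2 : ∀ r : ℝ, ∑ i, c i * ((r • w) i : ℝ) = r * ∑ i, c i * (w i : ℝ) := by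
      intro r
      simp only [Finset.mul_sum, PiLp.smul_apply, smul_eq_mul, ofReal_mul]
      exact Finset.sum_congr rfl fun i _ => by ring
    rw [smul_neg, ← neg_smul, h, h, e1, e1, e2, e2, mul_mul_mul_comm, ← Complex.exp_add,
      norm_mul, Complex.norm_exp, norm_mul, ← pow_two]
    refine le_mul_of_one_le_right (by positivity) (Real.one_le_exp ?_)
    have e3 : -((s : ℂ) ^ 2 * b) + s * ∑ i, c i * (w i : ℝ) +
        (-(((-s : ℝ) : ℂ) ^ 2 * b) + ((-s : ℝ) : ℂ) * ∑ i, c i * (w i : ℝ)) =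
        ((-2 * s ^ 2 : ℝ) : ℂ) * b := by
      push_cast
      ring
    rw [e3, re_ofReal_mul]
    nlinarith [sq_nonneg s]
  have h0 : ‖F0‖ ^ 2 ≤ 0 := ge_of_tendsto hlim (Filter.Eventually.of_forall hge)
  have : 0 < ‖F0‖ := norm_pos_iff.2 hF0
  nlinarith

open MvPolynomial in
/-- An integrable function whose Fourier transform is the exponential of a quadratic polynomial
is itself the exponential of a quadratic polynomial. -/
theorem exists_polynomial_of_fourier_eq_cexp {g : E → ℂ} (hg : Integrable g) {F0 : ℂ}
    (hF0 : F0 ≠ 0) {B : Matrix (Fin d) (Fin d) ℂ} (hB : B.IsSymm) {c : Fin d → ℂ}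
    (h : ∀ ξ : E, 𝓕 g ξ = F0 * cexp (-∑ i, ∑ j, B i j * ξ i * ξ j + ∑ i, c i * ξ i)) :
    ∃ Q : MvPolynomial (Fin d) ℂ, Q.totalDegree ≤ 2 ∧
      g =ᵐ[volume] fun x => cexp (MvPolynomial.eval (fun i => ((x i : ℝ) : ℂ)) Q) := by
  obtain ⟨hint, K, N, hK, hval⟩ := integral_cexp_neg_quadratic_add_linear hB
    (posDef_of_fourier_eq_cexp hF0 hB h)
  have hmp := PiLp.volume_preserving_toLp (Fin d)
  have hemb := (MeasurableEquiv.toLp 2 (Fin d → ℝ)).measurableEmbedding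
  have hFg : Integrable (𝓕 g) := by
    rw [← hmp.integrable_comp_emb hemb]
    refine ((hint c).const_mul F0).congr (Filter.Eventually.of_forall fun v => ?_)
    simp [h]
  -- The inversion kernel merely shifts the linear coefficient `c` by `2πi x`.
  have hinv : ∀ x : E, 𝓕⁻ (𝓕 g) x =
      F0 * (K * cexp (∑ i, ∑ j, N i j * (c i + 2 * Real.pi * I * x i) *
        (c j + 2 * Real.pi * I * x j))) := by
    intro x
    rw [Real.fourierInv_eq', ← hval (fun i => c i + 2 * Real.pi * I * x i), ← integral_const_mul,
      ← hmp.integral_comp hemb]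
    refine integral_congr_ae (Filter.Eventually.of_forall fun v => ?_)
    simp only [h, smul_eq_mul]
    rw [mul_left_comm, ← Complex.exp_add]
    congr 2
    simp only [PiLp.inner_apply, RCLike.inner_apply, conj_trivial, ofReal_mul, ofReal_sum,
      Finset.mul_sum, Finset.sum_mul, add_mul, Finset.sum_add_distrib]
    have : ∑ i, (((2 : ℝ) : ℂ) * Real.pi * ((x i : ℂ) * v i)) * I =
        ∑ i, 2 * (Real.pi : ℂ) * I * x i * v i :=
      Finset.sum_congr rfl fun i _ => by push_cast; ring
    rw [this]
    ring
  refine ⟨C (log (F0 * K)) + ∑ i, ∑ j, C (N i j) * (C (c i) + C (2 * Real.pi * I) * X i) *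
      (C (c j) + C (2 * Real.pi * I) * X j), ?_, ?_⟩
  · have hlin : ∀ i : Fin d, (C (c i) + C (2 * Real.pi * I) * X i :
        MvPolynomial (Fin d) ℂ).totalDegree ≤ 1 := by
      intro i
      refine (totalDegree_add _ _).trans (max_le (by simp) ?_)
      refine (totalDegree_mul _ _).trans ?_
      rw [totalDegree_C, totalDegree_X]
    refine (totalDegree_add _ _).trans (max_le (by simp) ?_)
    refine totalDegree_finsetSum_le fun i _ => totalDegree_finsetSum_le fun j _ => ?_
    refine (totalDegree_mul _ _).trans ?_
    have h1 := (totalDegree_mul (C (N i j)) (C (c i) + C (2 * Real.pi * I) * X i))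
    rw [totalDegree_C] at h1
    have := hlin i
    have := hlin j
    omega
  · refine (ae_eq_fourierInv_fourier hg hFg).trans (Filter.Eventually.of_forall fun x => ?_)
    simp only [hinv, map_add, map_sum, map_mul, eval_C, eval_X]
    rw [Complex.exp_add, Complex.exp_log (mul_ne_zero hF0 hK), ← mul_assoc F0 K]

end Euclidean

/-! ### Conclusion of the argument -/

section Hudson

variable {d : ℕ} {f : EuclideanSpace ℝ (Fin d) → ℂ}

local notation "E" => EuclideanSpace ℝ (Fin d)

/-- The Fourier transform of `f` times a Gaussian is the exponential of a quadratic polynomial if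
the Wigner distribution of `f` has constant sign. -/
theorem exists_fourier_mul_gaussian_eq (hf : MemLp f 2 volume) {σ : ℝ}
    (hσ : ∀ x ξ : E, 0 < σ * (wigner f f x ξ).re) :
    ∃ (F0 : ℂ) (B : Matrix (Fin d) (Fin d) ℂ) (c : Fin d → ℂ), F0 ≠ 0 ∧ B.IsSymm ∧
      ∀ ξ : E, 𝓕 (fun t => f t * Real.exp (-Real.pi * ‖t‖ ^ 2)) ξ =
        F0 * cexp (-∑ i, ∑ j, B i j * ξ i * ξ j + ∑ i, c i * ξ i) := by
  set g : E → ℂ := fun t => f t * Real.exp (-Real.pi * ‖t‖ ^ 2)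
  have hg : ExpIntegrable g := expIntegrable_mul_gaussian hf Real.pi_pos
  set e : Fin d → E →L[ℝ] ℝ := fun i => (2 * Real.pi) • EuclideanSpace.proj i
  set l : E → E →L[ℝ] ℝ := fun ξ => (2 * Real.pi) • innerSL ℝ ξ
  have hl : ∀ ξ t, l ξ t = 2 * Real.pi * inner ℝ ξ t := fun ξ t => by simp [l]
  have hle : ∀ ξ t, ((l ξ t : ℝ) : ℂ) = ∑ i, (ξ i : ℂ) * e i t := by
    intro ξ t
    rw [hl, PiLp.inner_apply, Finset.mul_sum, ofReal_sum]
    refine Finset.sum_congr rfl fun i _ => ?_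
    have he : e i t = 2 * Real.pi * t i := rfl
    simp only [he, RCLike.inner_apply, conj_trivial]
    push_cast
    ring
  -- First and second moments of `g`, scaled by `2π` per factor: they express the derivatives at `z
  -- = 0` as forms in `ξ`.
  set m : Fin d → ℂ := fun i => ∫ t, g t * e i t
  set M : Fin d → Fin d → ℂ := fun i j => ∫ t, g t * e i t * e j t
  set F0 : ℂ := ∫ t, g t
  have hne : ∀ ξ z, ∫ t, g t * cexp (z * l ξ t) ≠ 0 := by
    intro ξ z
    simp_rw [hl]
    exact integral_mul_gaussian_ne_zero hf hσ ξ z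
  have hF0 : F0 ≠ 0 := by simpa using hne 0 0
  have hfirst : ∀ ξ, ∫ t, g t * l ξ t = ∑ i, ξ i * m i := by
    intro ξ
    simp_rw [hle, Finset.mul_sum, m, ← integral_const_mul]
    rw [← integral_finsetSum _ fun i _ => (hg.mul_clm (e i)).integrable.const_mul _]
    refine integral_congr_ae (Filter.Eventually.of_forall fun t => ?_)
    exact Finset.sum_congr rfl fun i _ => by ring
  have hsecond : ∀ ξ, ∫ t, g t * l ξ t * l ξ t = ∑ i, ∑ j, ξ i * ξ j * M i j := by
    intro ξ
    have hi : ∀ i j, Integrable fun t => (ξ i : ℂ) * ξ j * (g t * e i t * e j t) := fun i j =>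
      (((hg.mul_clm (e i)).mul_clm (e j)).integrable).const_mul _
    simp_rw [M, ← integral_const_mul]
    simp_rw [← integral_finsetSum _ fun j _ => hi _ j]
    rw [← integral_finsetSum _ fun i _ => integrable_finsetSum _ fun j _ => hi i j]
    refine integral_congr_ae (Filter.Eventually.of_forall fun t => ?_)
    simp only [hle]
    rw [mul_assoc, Finset.sum_mul_sum, Finset.mul_sum]
    refine Finset.sum_congr rfl fun i _ => ?_
    rw [Finset.mul_sum]
    exact Finset.sum_congr rfl fun j _ => by ring
  -- These are the Taylor coefficients of the logarithm, evaluated at `z = -I`; `z² = -1` accounts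
  -- for the minus sign in front of `B`.
  refine ⟨F0, fun i j => (M i j / F0 - m i / F0 * (m j / F0)) / 2, fun i => -I * (m i / F0), hF0,
    ?_, fun ξ => ?_⟩
  · refine Matrix.IsSymm.ext fun i j => ?_
    have : M j i = M i j := integral_congr_ae (Filter.Eventually.of_forall fun t => by ring)
    change (M j i / F0 - m j / F0 * (m i / F0)) / 2 = (M i j / F0 - m i / F0 * (m j / F0)) / 2
    rw [this, mul_comm (m j / F0)]
  · have hd1 := hg.hasDerivAt_integral (l ξ)
    have hd2 := (hg.mul_clm (l ξ)).hasDerivAt_integral (l ξ) 0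
    have key := entire_eq_cexp_quadratic hd1 hd2 (hne ξ) (by positivity)
      (norm_laplace_gaussian_le hf Real.pi_pos (l ξ)) (-I)
    simp only [zero_mul, Complex.exp_zero, mul_one] at key
    rw [hfirst, hsecond] at key
    have hFT : 𝓕 g ξ = ∫ t, g t * cexp (-I * l ξ t) := by
      rw [Real.fourier_eq']
      refine integral_congr_ae (Filter.Eventually.of_forall fun t => ?_)
      simp only [hl, smul_eq_mul]
      rw [mul_comm, real_inner_comm]
      push_cast
      ring_nf
    rw [hFT, key]
    change F0 * _ = F0 * _
    congr 2
    have e1 : ∑ i, -I * (m i / F0) * (ξ i : ℂ) = (∑ i, ξ i * m i) / F0 * -I := by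
      rw [Finset.sum_div, Finset.sum_mul]
      exact Finset.sum_congr rfl fun i _ => by ring
    have e2 : ∑ i, ∑ j, (M i j / F0 - m i / F0 * (m j / F0)) / 2 * (ξ i : ℂ) * ξ j =
        ((∑ i, ∑ j, ξ i * ξ j * M i j) / F0 - ((∑ i, ξ i * m i) / F0) ^ 2) / 2 := by
      rw [pow_two, div_mul_div_comm, Finset.sum_mul_sum, Finset.sum_div, Finset.sum_div,
        ← Finset.sum_sub_distrib, Finset.sum_div]
      refine Finset.sum_congr rfl fun i _ => ?_
      rw [Finset.sum_div, Finset.sum_div, ← Finset.sum_sub_distrib, Finset.sum_div]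
      exact Finset.sum_congr rfl fun j _ => by ring
    rw [e1, e2, neg_sq, I_sq]
    change (∑ i, ξ i * m i) / F0 * -I + ((∑ i, ∑ j, ξ i * ξ j * M i j) / F0 -
      ((∑ i, ξ i * m i) / F0) ^ 2) / 2 * -1 = _
    ring

open MvPolynomial in
/-- **Hudson's theorem** for Wigner distributions without zeros. -/
theorem isGeneralizedGaussian_of_wigner_ne_zero (hf : MemLp f 2 volume)
    (h0 : ∀ x ξ : E, wigner f f x ξ ≠ 0) : IsGeneralizedGaussian f := by
  refine ⟨hf, ?_⟩
  obtain ⟨σ, hσ⟩ := exists_sign_wigner hf h0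
  obtain ⟨F0, B, c, hF0, hB, hFT⟩ := exists_fourier_mul_gaussian_eq hf hσ
  obtain ⟨Q, hQ, hgQ⟩ := exists_polynomial_of_fourier_eq_cexp
    (expIntegrable_mul_gaussian hf Real.pi_pos).integrable hF0 hB hFT
  -- The added term `π‖t‖²` undoes the damping factor.
  refine ⟨Q + ∑ i, C (Real.pi : ℂ) * X i ^ 2, ?_, ?_⟩
  · refine (totalDegree_add _ _).trans (max_le hQ ?_)
    refine totalDegree_finsetSum_le fun i _ => (totalDegree_mul _ _).trans ?_
    rw [totalDegree_C, totalDegree_X_pow]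
  · filter_upwards [hgQ] with t ht
    have hnorm : ((Real.pi * ‖t‖ ^ 2 : ℝ) : ℂ) = ∑ i, (Real.pi : ℂ) * (t i : ℂ) ^ 2 := by
      rw [EuclideanSpace.real_norm_sq_eq, Finset.mul_sum]
      push_cast
      rfl
    simp only [map_add, map_sum, map_mul, map_pow, eval_C, eval_X]
    rw [Complex.exp_add, ← ht, ← hnorm, mul_assoc, ← ofReal_exp, ← ofReal_mul, ← Real.exp_add]
    simp

end Hudson

end TimeFrequency

end

theorem mainTheorem4 {d : ℕ} (f : EuclideanSpace ℝ (Fin d) → ℂ) (hf : MemLp f 2 volume) :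
    ((∀ x ξ : EuclideanSpace ℝ (Fin d), TimeFrequency.wigner f f x ξ ≠ 0) →
      TimeFrequency.IsGeneralizedGaussian f) ∧
    ((∀ x ξ : EuclideanSpace ℝ (Fin d),
        TimeFrequency.stft (TimeFrequency.reflection f) f x ξ ≠ 0) →
      TimeFrequency.IsGeneralizedGaussian f) := by
  refine ⟨TimeFrequency.isGeneralizedGaussian_of_wigner_ne_zero hf, fun h =>
    TimeFrequency.isGeneralizedGaussian_of_wigner_ne_zero hf fun x ξ => ?_⟩
  -- The prefactor, `2^d` times an exponential, never vanishes, so the hypothesis at `(2x, 2ξ)`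
  -- suffices.
  rw [TimeFrequency.wigner_eq_stft_reflection]
  exact mul_ne_zero (mul_ne_zero (by simp) (Complex.exp_ne_zero _)) (h _ _)
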